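/- Let $n\ge 2$, $q=2n+1$, and let $\mathcal A=\langle(1,2n-2)\rangle\subseteq\mathbb Z_q\times\mathbb Z_q$ be the cyclic subgroup of codewords generated by $(1,2n-2)$. A polyomino is a nonempty finite edge-connected set of unit cells of the square tiling of the plane. Say that a polyomino $P$ of area $q$ *tessellates* (with respect to $\mathcal A$) if every cell of the $q\times q$ torus lattice $\mathbb Z_q\times\mathbb Z_q$ lies in exactly one of the translates of $P$ by the codewords of $\mathcal A$, and is covered exactly once by it. For such a $P$, identify the edges and vertices of $P$ that differ, modulo $q$, by a codeword of $\mathcal A$. Place a qubit on each of the resulting edges, let $A_v$ be the product of $\sigma_x$ over the edges incident to the vertex $v$, let $B_f$ be the product of $\sigma_z$ over the edges bounding the cell $f$ of $P$, and let $C_P$ be the space of states fixed by all the $A_v$ and $B_f$ (the toric code of the tessellation). Put $d=3$ if $n\in\{2,3,4\}$ and $d=4$ if $n\ge5$. Then: 1. there is a polyomino $P$ of area $q$ that tessellates; 2. the minimum Mannheim weight $d_M=\min\{|x|+|y| : (x,y)\in\mathcal A\setminus\{(0,0)\}\}$, where $|x|,|y|$ are the absolute values of the absolutely least residues modulo $q$,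 equals $d$; 3. for every polyomino $P$ of area $q$ that tessellates, $C_P$ is a stabilizer code (the common $+1$-eigenspace of an abelian subgroup of the Pauli group) with parameters $[[2q,2,d]]$: there are $2q$ qubits, $\dim C_P=2^2$, and $d$ is the least weight of a Pauli error that $C_P$ does not detect, where an operator $E$ is detected by $C_P$ if there is $c\in\mathbb C$ with $\langle\psi|E|\varphi\rangle=c\,\langle\psi|\varphi\rangle$ for all $\psi,\varphi\in C_P$. -/

import Mathlib

noncomputable section

namespace ToricCode

/-! ## Qubits, Pauli operators, quantum codes -/

/-- The four Pauli labels. -/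
inductive Pauli where
  | I | X | Y | Z
  deriving DecidableEq

/-- The `2 × 2` Pauli matrices. -/
def Pauli.toMatrix : Pauli → Matrix (Fin 2) (Fin 2) ℂ
  | .I => !![1, 0; 0, 1]
  | .X => !![0, 1; 1, 0]
  | .Y => !![0, -Complex.I; Complex.I, 0]
  | .Z => !![1, 0; 0, -1]

section Codes

variable {ι : Type*} [Fintype ι] [DecidableEq ι]

/-- The tensor product `⨂ j, σ j` of Pauli matrices, one for each qubit `j : ι`, as an operator on
`(ℂ²)^{⊗ ι}`, whose standard basis is indexed by the bit strings `ι → Fin 2`. -/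
def pauliOp (σ : ι → Pauli) : Matrix (ι → Fin 2) (ι → Fin 2) ℂ :=
  Matrix.of fun s t => ∏ j, (σ j).toMatrix (s j) (t j)

/-- The number of qubits on which a tensor product of Pauli matrices is not the identity. -/
def pauliWeight (σ : ι → Pauli) : ℕ := (Finset.univ.filter fun j => σ j ≠ Pauli.I).card

/-- Membership in the Pauli group: a power of `i` times a tensor product of Pauli matrices. -/
def IsPauli (M : Matrix (ι → Fin 2) (ι → Fin 2) ℂ) : Prop :=
  ∃ (k : ℕ) (σ : ι → Pauli), M = Complex.I ^ k • pauliOp σ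

/-- A stabilizer code: the simultaneous eigenspace with eigenvalue `1` of all the elements of an
abelian subgroup of the Pauli group. -/
def IsStabilizerCode (C : Submodule ℂ ((ι → Fin 2) → ℂ)) : Prop :=
  ∃ S : Subgroup (Matrix (ι → Fin 2) (ι → Fin 2) ℂ)ˣ,
    (∀ M ∈ S, IsPauli (M : Matrix (ι → Fin 2) (ι → Fin 2) ℂ)) ∧
    (∀ M ∈ S, ∀ N ∈ S, M * N = N * M) ∧
    ∀ ψ, ψ ∈ C ↔ ∀ M ∈ S, (M : Matrix (ι → Fin 2) (ι → Fin 2) ℂ).mulVec ψ = ψ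

/-- An error `M` is detectable by the code `C` if `⟨ψ|M|φ⟩ = c ⟨ψ|φ⟩` on `C` for a constant `c`
(the Knill–Laflamme condition). -/
def IsDetectable (C : Submodule ℂ ((ι → Fin 2) → ℂ))
    (M : Matrix (ι → Fin 2) (ι → Fin 2) ℂ) : Prop :=
  ∃ c : ℂ, ∀ ψ ∈ C, ∀ φ ∈ C, star ψ ⬝ᵥ M.mulVec φ = c * (star ψ ⬝ᵥ φ)

/-- `C` is an `[[n, k, d]]` quantum code: it has `n` physical qubits, encodes `k` qubits, that is,
`dim C = 2 ^ k`, and `d` is the least weight of a Pauli error which `C` does not detect. -/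
def HasParameters (C : Submodule ℂ ((ι → Fin 2) → ℂ)) (n k d : ℕ) : Prop :=
  Fintype.card ι = n ∧ Module.finrank ℂ C = 2 ^ k ∧
    IsLeast {w : ℕ | ∃ σ : ι → Pauli, ¬ IsDetectable C (pauliOp σ) ∧ pauliWeight σ = w} d

end Codes

/-! ## Polyominoes and tessellations of the `q × q` square lattice -/

/-- Two cells of the square tiling of the plane are adjacent if they share an edge. -/
def cellGraph : SimpleGraph (ℤ × ℤ) where
  Adj a b := |a.1 - b.1| + |a.2 - b.2| = 1
  symm := ⟨fun a b h => by rw [abs_sub_comm b.1, abs_sub_comm b.2]; exact h⟩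
  loopless := ⟨fun a h => by simp at h⟩

/-- A polyomino: a nonempty finite set of cells that is connected edge to edge. -/
def IsPolyomino (P : Finset (ℤ × ℤ)) : Prop :=
  (cellGraph.induce (P : Set (ℤ × ℤ))).Connected

/-- The cyclic classical code generated by `(1, g)` in `ℤ_q × ℤ_q`. -/
def cyclicCode (q : ℕ) (g : ℤ) : AddSubgroup (ZMod q × ZMod q) :=
  AddSubgroup.zmultiples ((1 : ZMod q), (g : ZMod q))

/-- The Mannheim weight `|x| + |y|`, where `x` and `y` are represented by the residues of least
absolute value. -/
def mannheimWeight {q : ℕ} (a : ZMod q × ZMod q) : ℕ :=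
  a.1.valMinAbs.natAbs + a.2.valMinAbs.natAbs

/-- `d` is the minimum Mannheim weight of a nonzero codeword. -/
def IsMinMannheim {q : ℕ} (A : AddSubgroup (ZMod q × ZMod q)) (d : ℕ) : Prop :=
  IsLeast {w : ℕ | ∃ a ∈ A, a ≠ 0 ∧ mannheimWeight a = w} d

/-- The cell of the `q × q` torus lattice below a cell of the plane. -/
def cellMod (q : ℕ) (c : ℤ × ℤ) : ZMod q × ZMod q := ((c.1 : ZMod q), (c.2 : ZMod q))

/-- `P` is a polyomino of area `q` whose translates by the codewords of `A` tessellate the `q × q`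
torus lattice: each cell of the lattice lies in exactly one translate, exactly once. -/
structure IsTessellation {q : ℕ} (A : AddSubgroup (ZMod q × ZMod q)) (P : Finset (ℤ × ℤ)) :
    Prop where
  polyomino : IsPolyomino P
  area : P.card = q
  tiles : ∀ x : ZMod q × ZMod q, ∃! pa : P × A,
    cellMod q (pa.1 : ℤ × ℤ) + (pa.2 : ZMod q × ZMod q) = x

/-! ## The toric code of a tessellation

The sides of a polyomino `P` are identified whenever a codeword of `A` translates one to the other
in the `q × q` torus lattice. The positions in the resulting surface are elements of the quotient
of `ℤ_q × ℤ_q` by `A`. A cell is given by the position of its corner with least coordinates, and an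
edge by a direction (`0` horizontal, `1` vertical) and the position of its first end. -/

section Toric

variable {q : ℕ} (A : AddSubgroup (ZMod q × ZMod q))

/-- Positions of the `q × q` torus lattice modulo translations by codewords. -/
abbrev Pos : Type := (ZMod q × ZMod q) ⧸ A

instance : DecidableEq (Pos A) := Classical.decEq _

/-- One step to the right. -/
def stepH : Pos A := QuotientAddGroup.mk (1, 0)

/-- One step in the vertical direction. -/
def stepV : Pos A := QuotientAddGroup.mk (0, 1)

/-- The position of a cell of the plane. -/
def pos (c : ℤ × ℤ) : Pos A := QuotientAddGroup.mk (cellMod q c)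

/-- The two ends of an edge. -/
def edgeEnds (e : Fin 2 × Pos A) : Finset (Pos A) :=
  {e.2, e.2 + (if e.1 = 0 then stepH A else stepV A)}

/-- The four edges that bound a cell. -/
def cellEdges (c : Pos A) : Finset (Fin 2 × Pos A) :=
  {(0, c), (0, c + stepV A), (1, c), (1, c + stepH A)}

/-- The four corners of a cell. -/
def cellCorners (c : Pos A) : Finset (Pos A) :=
  {c, c + stepH A, c + stepV A, c + stepH A + stepV A}

variable (P : Finset (ℤ × ℤ))

/-- The edges of the cells of the polyomino `P`, after identification. These are the qubits. -/
def polyominoEdges : Finset (Fin 2 × Pos A) := P.biUnion fun c => cellEdges A (pos A c)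

/-- The vertices of the cells of the polyomino `P`, after identification. -/
def polyominoVertices : Finset (Pos A) := P.biUnion fun c => cellCorners A (pos A c)

/-- The vertex operator: `σ_x` on the edges that have `v` as an end. -/
def vertexOp (v : Pos A) :
    Matrix (polyominoEdges A P → Fin 2) (polyominoEdges A P → Fin 2) ℂ :=
  pauliOp fun j => if v ∈ edgeEnds A (j : Fin 2 × Pos A) then Pauli.X else Pauli.I

/-- The face operator: `σ_z` on the edges that bound the cell `c`. -/
def faceOp (c : Pos A) :
    Matrix (polyominoEdges A P → Fin 2) (polyominoEdges A P → Fin 2) ℂ :=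
  pauliOp fun j => if (j : Fin 2 × Pos A) ∈ cellEdges A c then Pauli.Z else Pauli.I

/-- The toric code of the tessellation by translates of `P`: the space fixed by all the vertex
operators and all the face operators. -/
def toricCode : Submodule ℂ ((polyominoEdges A P → Fin 2) → ℂ) where
  carrier := {ψ | (∀ v ∈ polyominoVertices A P, (vertexOp A P v).mulVec ψ = ψ) ∧
    ∀ c ∈ P, (faceOp A P (pos A c)).mulVec ψ = ψ}
  add_mem' := by
    rintro ψ φ ⟨h₁, h₂⟩ ⟨k₁, k₂⟩
    exact ⟨fun v hv => by rw [Matrix.mulVec_add, h₁ v hv, k₁ v hv],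
      fun c hc => by rw [Matrix.mulVec_add, h₂ c hc, k₂ c hc]⟩
  zero_mem' := ⟨fun _ _ => Matrix.mulVec_zero _, fun _ _ => Matrix.mulVec_zero _⟩
  smul_mem' := by
    rintro a ψ ⟨h₁, h₂⟩
    exact ⟨fun v hv => by rw [Matrix.mulVec_smul, h₁ v hv],
      fun c hc => by rw [Matrix.mulVec_smul, h₂ c hc]⟩

end Toric

end ToricCode

end

noncomputable section

namespace ToricCode

open scoped Fin.CommRing

/-! Since `2n - 2 = -3` in `ZMod q`, the code is the kernel of `(x, y) ↦ 3x + y`, and the quotient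
of the torus lattice by it is `ZMod q`, with horizontal step `3` and vertical step `1`. A
tessellating polyomino meets every class, so its toric code does not depend on `P`: it is the CSS
code of one circulant torus (`toricCode_eq_cssCode`), with bit flips along coboundaries of vertex
functions and phase flips along boundaries of face functions.

A bit-flip error commuting with the face operators is a closed cochain `(h, w)`, that is, a function
on horizontal and on vertical edges. As `q` is odd, its class is the pair `(∑ h, ∑ w)` modulo 2
(`exact_of_closed`), so there are four classes and the code space has dimension 4.

The lower bound on the distance is an averaging argument (`loop_sum_eq_zero`). A closed cochain has
the same sum along all `q` translates of a loop. If that sum is 1, the support meets every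
translate; but if the loop has at most `m` steps of each kind, each edge lies on at most `m` of
them, so `m` times the weight is at least `q`. Two loops independent modulo 2, with `m * (d - 1) <
q`, therefore make every closed cochain of weight less than `d` exact. Phase flips reduce to this by
the self-duality `v ↦ -v`. The upper bound comes from the dual of a loop with `d` steps
(`loop_closed`).

The Mannheim distance is a separate computation with short integer vectors satisfying `q ∣ 3x + y`.
-/

/-! ## Weyl operators over bit strings -/

/-- The nontrivial character of `Fin 2`. -/
def sgn (a : Fin 2) : ℂ := if a = 0 then 1 else -1

@[simp] theorem sgn_zero : sgn 0 = 1 := by simp [sgn]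

@[simp] theorem sgn_one : sgn 1 = -1 := by simp [sgn]

theorem sgn_add (a b : Fin 2) : sgn (a + b) = sgn a * sgn b := by
  fin_cases a <;> fin_cases b <;> simp [sgn]

theorem sgn_sum {κ : Type*} (s : Finset κ) (f : κ → Fin 2) :
    sgn (∑ j ∈ s, f j) = ∏ j ∈ s, sgn (f j) := by
  classical
  induction s using Finset.induction_on with
  | empty => simp
  | insert a s ha ih => rw [Finset.sum_insert ha, Finset.prod_insert ha, sgn_add, ih]

theorem fin_two_eq_one_of_ne_zero {a : Fin 2} (h : a ≠ 0) : a = 1 := by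
  revert h; revert a; decide

theorem fin_two_add_self (a : Fin 2) : a + a = 0 := by
  revert a; decide

theorem fin_two_neg (a : Fin 2) : -a = a := by
  revert a; decide

theorem pi_fin_two_add_self {ι : Type*} (a : ι → Fin 2) : a + a = 0 :=
  funext fun j => fin_two_add_self (a j)

theorem pi_fin_two_neg {ι : Type*} (a : ι → Fin 2) : -a = a :=
  funext fun j => fin_two_neg (a j)

/-- The bit-flip part of a Pauli label. -/
def Pauli.xPart : Pauli → Fin 2
  | .I => 0
  | .X => 1
  | .Y => 1
  | .Z => 0

/-- The phase-flip part of a Pauli label. -/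
def Pauli.zPart : Pauli → Fin 2
  | .I => 0
  | .X => 0
  | .Y => 1
  | .Z => 1

/-- The exponent of `i` in `σ = i ^ k X ^ a Z ^ b`. -/
def Pauli.phase : Pauli → ℕ
  | .Y => 1
  | _ => 0

/-- The Pauli label with given bit-flip and phase-flip parts. -/
def Pauli.ofParts (a b : Fin 2) : Pauli :=
  if a = 0 then (if b = 0 then .I else .Z) else (if b = 0 then .X else .Y)

theorem Pauli.xPart_ofParts (a b : Fin 2) : (Pauli.ofParts a b).xPart = a := by
  revert a b; decide

theorem Pauli.zPart_ofParts (a b : Fin 2) : (Pauli.ofParts a b).zPart = b := by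
  revert a b; decide

theorem Pauli.toMatrix_apply (p : Pauli) (s t : Fin 2) :
    p.toMatrix s t =
      if s = t + p.xPart then Complex.I ^ p.phase * sgn (p.zPart * t) else 0 := by
  cases p <;> fin_cases s <;> fin_cases t <;>
    simp [Pauli.toMatrix, Pauli.xPart, Pauli.zPart, Pauli.phase]

set_option linter.unusedSectionVars false

section

variable {ι : Type*} [Fintype ι] [DecidableEq ι]

/-- The operator `X ^ a Z ^ b`. -/
def weyl (a b : ι → Fin 2) : Matrix (ι → Fin 2) (ι → Fin 2) ℂ :=
  Matrix.of fun s t => if s = t + a then sgn (b ⬝ᵥ t) else 0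

theorem pauliOp_eq_weyl (σ : ι → Pauli) :
    pauliOp σ = Complex.I ^ (∑ j, (σ j).phase) •
      weyl (fun j => (σ j).xPart) (fun j => (σ j).zPart) := by
  ext s t
  simp only [pauliOp, weyl, Matrix.of_apply, Matrix.smul_apply, smul_eq_mul,
    Pauli.toMatrix_apply]
  split_ifs with h
  · rw [dotProduct, sgn_sum, ← Finset.prod_pow_eq_pow_sum, ← Finset.prod_mul_distrib]
    exact Finset.prod_congr rfl fun j _ => if_pos (congrFun h j)
  · obtain ⟨j, hj⟩ := Function.ne_iff.1 h
    rw [mul_zero]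
    exact Finset.prod_eq_zero (Finset.mem_univ j) (if_neg hj)

theorem eq_add_iff_add_eq (s t a : ι → Fin 2) : s = t + a ↔ t = s + a := by
  constructor <;> rintro rfl <;> rw [add_assoc, pi_fin_two_add_self, add_zero]

theorem weyl_mulVec (a b : ι → Fin 2) (ψ : (ι → Fin 2) → ℂ) (s : ι → Fin 2) :
    (weyl a b).mulVec ψ s = sgn (b ⬝ᵥ (s + a)) * ψ (s + a) := by
  simp only [Matrix.mulVec, dotProduct, weyl, Matrix.of_apply, ite_mul, zero_mul]
  simp_rw [eq_add_iff_add_eq s _ a]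
  rw [Finset.sum_ite_eq' Finset.univ (s + a)]
  simp

/-- The sign is the cost of moving `Z ^ b` past `X ^ a'`; it disappears when `b` and `a'` are
orthogonal, which is why orthogonality makes the stabilizer an abelian group. -/
theorem weyl_mul (a b a' b' : ι → Fin 2) :
    weyl a b * weyl a' b' = sgn (b ⬝ᵥ a') • weyl (a + a') (b + b') := by
  ext s t
  have h : (weyl a b * weyl a' b') s t = (weyl a b).mulVec (fun k => weyl a' b' k t) s := rfl
  rw [h, weyl_mulVec]
  simp only [weyl, Matrix.of_apply, Matrix.smul_apply, smul_eq_mul]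
  have e : s + a = t + a' ↔ s = t + (a + a') := by
    rw [eq_comm, ← eq_add_iff_add_eq, eq_add_iff_add_eq, eq_comm]
    constructor
    · intro h; rw [eq_comm, eq_add_iff_add_eq] at h; rw [h]; abel
    · intro h; rw [eq_comm, eq_add_iff_add_eq, h]; abel
  by_cases hs : s = t + (a + a')
  · rw [if_pos hs, if_pos (e.2 hs), e.2 hs, dotProduct_add, add_dotProduct, sgn_add, sgn_add]
    ring
  · rw [if_neg hs, if_neg (mt e.1 hs)]
    simp

theorem weyl_zero : weyl (0 : ι → Fin 2) 0 = 1 := by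
  ext s t
  simp [weyl, Matrix.one_apply]

theorem isPauli_weyl (a b : ι → Fin 2) : IsPauli (weyl a b) := by
  -- Each `Y` contributes a factor `i`; the cube of the total phase is its inverse.
  refine ⟨3 * ∑ j, (Pauli.ofParts (a j) (b j)).phase, fun j => Pauli.ofParts (a j) (b j), ?_⟩
  rw [pauliOp_eq_weyl, smul_smul, ← pow_add, ← Nat.succ_mul, pow_mul, Complex.I_pow_four,
    one_pow, one_smul]
  simp only [Pauli.xPart_ofParts, Pauli.zPart_ofParts]

/-! ## Calderbank–Shor–Steane codes -/

/-- The code stabilized by the operators `X ^ a` for `a ∈ B` and `Z ^ b` for `b ∈ B'`. -/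
def cssCode (B B' : AddSubgroup (ι → Fin 2)) : Submodule ℂ ((ι → Fin 2) → ℂ) where
  carrier := {ψ | (∀ a ∈ B, ∀ s, ψ (s + a) = ψ s) ∧
    ∀ b ∈ B', ∀ s, sgn (b ⬝ᵥ s) * ψ s = ψ s}
  add_mem' := by
    rintro ψ φ ⟨h₁, h₂⟩ ⟨k₁, k₂⟩
    exact ⟨fun a ha s => by simp only [Pi.add_apply, h₁ a ha s, k₁ a ha s],
      fun b hb s => by simp only [Pi.add_apply, mul_add, h₂ b hb s, k₂ b hb s]⟩
  zero_mem' := ⟨fun _ _ _ => rfl, fun _ _ _ => mul_zero _⟩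
  smul_mem' := by
    rintro c ψ ⟨h₁, h₂⟩
    exact ⟨fun a ha s => by simp only [Pi.smul_apply, h₁ a ha s],
      fun b hb s => by simp only [Pi.smul_apply, smul_eq_mul, mul_left_comm _ c, h₂ b hb s]⟩

variable {B B' : AddSubgroup (ι → Fin 2)}

theorem cssCode_apply_eq_zero {ψ : (ι → Fin 2) → ℂ} (hψ : ψ ∈ cssCode B B') {b s : ι → Fin 2}
    (hb : b ∈ B') (h : b ⬝ᵥ s ≠ 0) : ψ s = 0 := by
  have := hψ.2 b hb s
  rw [fin_two_eq_one_of_ne_zero h, sgn_one] at this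
  linear_combination (-1 / 2) * this

/-- The stabilizer group of a CSS code. -/
def cssStabilizer (hperp : ∀ a ∈ B, ∀ b ∈ B', b ⬝ᵥ a = 0) :
    Subgroup (Matrix (ι → Fin 2) (ι → Fin 2) ℂ)ˣ where
  carrier := {M | ∃ a ∈ B, ∃ b ∈ B', (M : Matrix (ι → Fin 2) (ι → Fin 2) ℂ) = weyl a b}
  mul_mem' := by
    rintro M N ⟨a, ha, b, hb, hM⟩ ⟨a', ha', b', hb', hN⟩
    refine ⟨a + a', add_mem ha ha', b + b', add_mem hb hb', ?_⟩
    rw [Units.val_mul, hM, hN, weyl_mul, hperp a' ha' b hb, sgn_zero, one_smul]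
  one_mem' := ⟨0, zero_mem _, 0, zero_mem _, by rw [weyl_zero, Units.val_one]⟩
  inv_mem' := by
    rintro M ⟨a, ha, b, hb, hM⟩
    refine ⟨a, ha, b, hb, ?_⟩
    have : M * M = 1 := by
      ext1
      rw [Units.val_mul, hM, weyl_mul, hperp a ha b hb, sgn_zero, one_smul,
        pi_fin_two_add_self, pi_fin_two_add_self, weyl_zero, Units.val_one]
    rw [inv_eq_of_mul_eq_one_left this, hM]

theorem isStabilizerCode_cssCode (hperp : ∀ a ∈ B, ∀ b ∈ B', b ⬝ᵥ a = 0) :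
    IsStabilizerCode (cssCode B B') := by
  have unit : ∀ a ∈ B, ∀ b ∈ B', ∃ M ∈ cssStabilizer hperp,
      (M : Matrix (ι → Fin 2) (ι → Fin 2) ℂ) = weyl a b := by
    intro a ha b hb
    have : weyl a b * weyl a b = 1 := by
      rw [weyl_mul, hperp a ha b hb, sgn_zero, one_smul,
        pi_fin_two_add_self, pi_fin_two_add_self, weyl_zero]
    exact ⟨⟨weyl a b, weyl a b, this, this⟩, ⟨a, ha, b, hb, rfl⟩, rfl⟩
  refine ⟨cssStabilizer hperp, ?_, ?_, fun ψ => ⟨?_, fun h => ⟨?_, ?_⟩⟩⟩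
  · rintro M ⟨a, -, b, -, hM⟩
    exact hM ▸ isPauli_weyl a b
  · rintro M ⟨a, ha, b, hb, hM⟩ N ⟨a', ha', b', hb', hN⟩
    ext1
    rw [Units.val_mul, Units.val_mul, hM, hN, weyl_mul, weyl_mul, hperp a ha b' hb',
      hperp a' ha' b hb, add_comm a, add_comm b]
  · rintro hψ M ⟨a, ha, b, hb, hM⟩
    ext s
    rw [hM, weyl_mulVec, hψ.2 b hb, hψ.1 a ha]
  · intro a ha s
    obtain ⟨M, hM, e⟩ := unit a ha 0 (zero_mem _)
    simpa [e, weyl_mulVec] using congrFun (h M hM) s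
  · intro b hb s
    obtain ⟨M, hM, e⟩ := unit 0 (zero_mem _) b hb
    simpa [e, weyl_mulVec] using congrFun (h M hM) s

/-! ### Dimension of a CSS code. -/

section Logical

variable {Q : Type*} [AddCommGroup Q] (cl : (ι → Fin 2) →+ Q)

/-- The basis state of a CSS code with a given class. -/
def classState (B' : AddSubgroup (ι → Fin 2)) (g : Q → ℂ) : (ι → Fin 2) → ℂ :=
  open Classical in fun s => if ∀ b ∈ B', b ⬝ᵥ s = 0 then g (cl s) else 0

variable {cl}

theorem classState_mem (hperp : ∀ a ∈ B, ∀ b ∈ B', b ⬝ᵥ a = 0) (hcl : ∀ a ∈ B, cl a = 0)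
    (g : Q → ℂ) : classState cl B' g ∈ cssCode B B' := by
  refine ⟨fun a ha s => ?_, fun b hb s => ?_⟩
  · have : (∀ b ∈ B', b ⬝ᵥ (s + a) = 0) ↔ ∀ b ∈ B', b ⬝ᵥ s = 0 :=
      forall₂_congr fun b hb => by rw [dotProduct_add, hperp a ha b hb, add_zero]
    simp only [classState, map_add, hcl a ha, add_zero]
    by_cases h : ∀ b ∈ B', b ⬝ᵥ s = 0
    · rw [if_pos h, if_pos (this.2 h)]
    · rw [if_neg h, if_neg (mt this.1 h)]
  · simp only [classState]
    split_ifs with h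
    · rw [h b hb, sgn_zero, one_mul]
    · rw [mul_zero]

/-- A code state vanishes off the orthogonal complement of `B'` and is constant on cosets of `B`, so
it is a function on the classes, read off at one representative `r κ` of each. -/
theorem finrank_cssCode [Fintype Q] (hperp : ∀ a ∈ B, ∀ b ∈ B', b ⬝ᵥ a = 0)
    (hcl : ∀ s, (∀ b ∈ B', b ⬝ᵥ s = 0) → (cl s = 0 ↔ s ∈ B))
    (hsurj : ∀ κ, ∃ s, (∀ b ∈ B', b ⬝ᵥ s = 0) ∧ cl s = κ) :
    Module.finrank ℂ (cssCode B B') = Fintype.card Q := by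
  choose r hr hrc using hsurj
  let T : cssCode B B' →ₗ[ℂ] (Q → ℂ) :=
    { toFun := fun ψ κ => (ψ : (ι → Fin 2) → ℂ) (r κ)
      map_add' := fun _ _ => rfl
      map_smul' := fun _ _ => rfl }
  have hT : Function.Bijective T := by
    constructor
    · rw [← LinearMap.ker_eq_bot, LinearMap.ker_eq_bot']
      rintro ⟨ψ, hψ⟩ h0
      ext s
      by_cases hs : ∀ b ∈ B', b ⬝ᵥ s = 0
      · have hB : s + r (cl s) ∈ B := by
          refine (hcl _ fun b hb => ?_).1 ?_
          · rw [dotProduct_add, hs b hb, hr _ b hb, add_zero]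
          · rw [← pi_fin_two_neg (r (cl s)), map_add, map_neg, hrc, add_neg_cancel]
        have h1 : ψ (s + (s + r (cl s))) = ψ s := hψ.1 _ hB s
        rw [← add_assoc, pi_fin_two_add_self, zero_add] at h1
        exact h1.symm.trans (congrFun h0 (cl s))
      · push Not at hs
        obtain ⟨b, hb, hbs⟩ := hs
        exact cssCode_apply_eq_zero hψ hb hbs
    · intro g
      refine ⟨⟨classState cl B' g, classState_mem hperp (fun a ha => ?_) g⟩, ?_⟩
      · exact (hcl a (hperp a ha)).2 ha
      · ext κ
        exact (if_pos (hr κ)).trans (by rw [hrc])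
  rw [(LinearEquiv.ofBijective T hT).finrank_eq, Module.finrank_fintype_fun_eq_card]

end Logical

/-! ### Detectable and undetectable Weyl operators. -/

theorem star_dotProduct_weyl_mulVec (a b : ι → Fin 2) (ψ φ : (ι → Fin 2) → ℂ) (k : ℂ) :
    star ψ ⬝ᵥ (k • weyl a b).mulVec φ =
      ∑ s, star (ψ s) * (k * (sgn (b ⬝ᵥ (s + a)) * φ (s + a))) := by
  simp only [Matrix.smul_mulVec, dotProduct, Pi.star_apply, Pi.smul_apply, weyl_mulVec,
    smul_eq_mul]

/-- The operator anticommutes with the stabilizer `Z ^ c`: for every `s`, either `s` or `s + a` lies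
outside the support of all code states. -/
theorem isDetectable_of_dotProduct_ne_zero {a b c : ι → Fin 2} {k : ℂ} (hc : c ∈ B')
    (h : c ⬝ᵥ a ≠ 0) : IsDetectable (cssCode B B') (k • weyl a b) := by
  refine ⟨0, fun ψ hψ φ hφ => ?_⟩
  rw [star_dotProduct_weyl_mulVec, zero_mul]
  refine Finset.sum_eq_zero fun s _ => ?_
  by_cases hs : c ⬝ᵥ s = 0
  · rw [cssCode_apply_eq_zero hφ hc (s := s + a) (by rwa [dotProduct_add, hs, zero_add])]
    simp
  · rw [cssCode_apply_eq_zero hψ hc hs]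
    simp

/-- The operator anticommutes with `X ^ c`: the substitution `s ↦ s + c` reverses the sign of the
matrix element. -/
theorem isDetectable_of_dotProduct_ne_zero' {a b c : ι → Fin 2} {k : ℂ} (hc : c ∈ B)
    (h : b ⬝ᵥ c ≠ 0) : IsDetectable (cssCode B B') (k • weyl a b) := by
  refine ⟨0, fun ψ hψ φ hφ => ?_⟩
  rw [star_dotProduct_weyl_mulVec, zero_mul]
  set F : (ι → Fin 2) → ℂ := fun s => star (ψ s) * (k * (sgn (b ⬝ᵥ (s + a)) * φ (s + a)))
    with hF
  have h1 : ∑ s, F (s + c) = ∑ s, F s := Equiv.sum_comp (Equiv.addRight c) F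
  have h2 : ∀ s, F (s + c) = -F s := by
    intro s
    simp only [hF]
    rw [hψ.1 c hc, add_right_comm, hφ.1 c hc, dotProduct_add, fin_two_eq_one_of_ne_zero h,
      sgn_add, sgn_one]
    ring
  simp only [h2, Finset.sum_neg_distrib] at h1
  linear_combination (-1 / 2) * h1

theorem isDetectable_of_mem {a b : ι → Fin 2} {k : ℂ}
    (hperp : ∀ a ∈ B, ∀ b ∈ B', b ⬝ᵥ a = 0) (ha : a ∈ B) (hb : b ∈ B') :
    IsDetectable (cssCode B B') (k • weyl a b) := by
  refine ⟨k, fun ψ hψ φ hφ => ?_⟩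
  rw [star_dotProduct_weyl_mulVec, dotProduct, Finset.mul_sum]
  refine Finset.sum_congr rfl fun s _ => ?_
  rw [dotProduct_add, hperp a ha b hb, add_zero, hφ.1 a ha, hφ.2 b hb, Pi.star_apply]
  ring

theorem not_isDetectable_weyl {Q : Type*} [AddCommGroup Q] {cl : (ι → Fin 2) →+ Q}
    (hperp : ∀ a ∈ B, ∀ b ∈ B', b ⬝ᵥ a = 0) (hcl : ∀ a ∈ B, cl a = 0) {a : ι → Fin 2}
    (ha : ∀ b ∈ B', b ⬝ᵥ a = 0) (hne : cl a ≠ 0) {k : ℂ} (hk : k ≠ 0) :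
    ¬ IsDetectable (cssCode B B') (k • weyl a 0) := by
  classical
  rintro ⟨c, hc⟩
  -- The uniform states of the classes `0` and `cl a` are orthogonal, yet `X ^ a` carries one to the
  -- other.
  have h := hc _ (classState_mem hperp hcl (Pi.single 0 1)) _
    (classState_mem hperp hcl (Pi.single (cl a) 1))
  rw [star_dotProduct_weyl_mulVec] at h
  have h0 : star (classState cl B' (Pi.single 0 1)) ⬝ᵥ
      classState cl B' (Pi.single (cl a) (1 : ℂ)) = 0 := by
    refine Finset.sum_eq_zero fun s _ => ?_
    simp only [classState, Pi.star_apply]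
    by_cases hs : cl s = 0
    · rw [hs, Pi.single_eq_of_ne (Ne.symm hne)]
      simp
    · rw [Pi.single_eq_of_ne hs]
      simp
  have h1 : ∀ s, star (classState cl B' (Pi.single 0 1) s) *
      (k * (sgn (0 ⬝ᵥ (s + a)) * classState cl B' (Pi.single (cl a) 1) (s + a))) =
      if (∀ b ∈ B', b ⬝ᵥ s = 0) ∧ cl s = 0 then k else 0 := by
    intro s
    have : (∀ b ∈ B', b ⬝ᵥ (s + a) = 0) ↔ ∀ b ∈ B', b ⬝ᵥ s = 0 :=
      forall₂_congr fun b hb => by rw [dotProduct_add, ha b hb, add_zero]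
    simp only [classState, this, map_add, zero_dotProduct, sgn_zero]
    by_cases hs : ∀ b ∈ B', b ⬝ᵥ s = 0
    · by_cases h0 : cl s = 0
      · simp [if_pos hs, h0]
      · simp [h0]
    · simp [hs]
  rw [h0, mul_zero, Finset.sum_congr rfl fun s _ => h1 s, Finset.sum_ite, Finset.sum_const_zero,
    add_zero, Finset.sum_const, nsmul_eq_mul, mul_eq_zero, Nat.cast_eq_zero,
    Finset.card_eq_zero] at h
  refine h.elim (fun h => ?_) hk
  -- The matrix element is `k` times the number of vectors of class `0`, and the zero vector is one
  -- of them.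
  refine Finset.notMem_empty (0 : ι → Fin 2) (h ▸ ?_)
  simp

/-- The weight of a bit vector. -/
def bitWeight (a : ι → Fin 2) : ℕ := (Finset.univ.filter fun j => a j ≠ 0).card

theorem bitWeight_xPart_le (σ : ι → Pauli) :
    bitWeight (fun j => (σ j).xPart) ≤ pauliWeight σ :=
  Finset.card_le_card fun j => by
    simp only [Finset.mem_filter, Finset.mem_univ, true_and]
    intro h hj
    exact h (by rw [hj]; rfl)

theorem bitWeight_zPart_le (σ : ι → Pauli) :
    bitWeight (fun j => (σ j).zPart) ≤ pauliWeight σ :=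
  Finset.card_le_card fun j => by
    simp only [Finset.mem_filter, Finset.mem_univ, true_and]
    intro h hj
    exact h (by rw [hj]; rfl)

/-- The parameters of a CSS code, given a map `cl` that computes the classes of bit-flip errors. -/
theorem hasParameters_cssCode {Q : Type*} [AddCommGroup Q] [Fintype Q] {cl : (ι → Fin 2) →+ Q}
    {n k d : ℕ} (hn : Fintype.card ι = n) (hk : Fintype.card Q = 2 ^ k)
    (hperp : ∀ a ∈ B, ∀ b ∈ B', b ⬝ᵥ a = 0)
    (hcl : ∀ s, (∀ b ∈ B', b ⬝ᵥ s = 0) → (cl s = 0 ↔ s ∈ B))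
    (hsurj : ∀ κ, ∃ s, (∀ b ∈ B', b ⬝ᵥ s = 0) ∧ cl s = κ)
    (hX : ∀ s, (∀ b ∈ B', b ⬝ᵥ s = 0) → bitWeight s < d → s ∈ B)
    (hZ : ∀ s, (∀ a ∈ B, s ⬝ᵥ a = 0) → bitWeight s < d → s ∈ B')
    (hd : ∃ s, (∀ b ∈ B', b ⬝ᵥ s = 0) ∧ cl s ≠ 0 ∧ bitWeight s ≤ d) :
    HasParameters (cssCode B B') n k d := by
  have hlow : ∀ σ : ι → Pauli, ¬ IsDetectable (cssCode B B') (pauliOp σ) →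
      d ≤ pauliWeight σ := by
    intro σ hσ
    by_contra! hlt
    apply hσ
    rw [pauliOp_eq_weyl]
    -- Either the error anticommutes with a stabilizer, or both of its parts have weight below `d`
    -- and lie in the stabilizer, where it acts as a scalar.
    by_cases hx : ∀ b ∈ B', b ⬝ᵥ (fun j => (σ j).xPart) = 0
    · by_cases hz : ∀ a ∈ B, (fun j => (σ j).zPart) ⬝ᵥ a = 0
      · exact isDetectable_of_mem hperp (hX _ hx ((bitWeight_xPart_le σ).trans_lt hlt))
          (hZ _ hz ((bitWeight_zPart_le σ).trans_lt hlt))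
      · push Not at hz
        obtain ⟨c, hc, h⟩ := hz
        exact isDetectable_of_dotProduct_ne_zero' hc h
    · push Not at hx
      obtain ⟨c, hc, h⟩ := hx
      exact isDetectable_of_dotProduct_ne_zero hc h
  refine ⟨hn, (finrank_cssCode hperp hcl hsurj).trans hk, ?_, ?_⟩
  · obtain ⟨s, hs, hne, hw⟩ := hd
    have hnd : ¬ IsDetectable (cssCode B B') (pauliOp fun j => Pauli.ofParts (s j) 0) := by
      rw [pauliOp_eq_weyl]
      simp only [Pauli.xPart_ofParts, Pauli.zPart_ofParts]
      exact not_isDetectable_weyl hperp (fun a ha => (hcl a (hperp a ha)).2 ha) hs hne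
        (pow_ne_zero _ Complex.I_ne_zero)
    refine ⟨_, hnd, le_antisymm (le_trans ?_ hw) (hlow _ hnd)⟩
    refine Finset.card_le_card fun j => ?_
    simp only [Finset.mem_filter, Finset.mem_univ, true_and]
    intro h hj
    exact h (by rw [hj]; rfl)
  · rintro w ⟨σ, hσ, rfl⟩
    exact hlow σ hσ

end

/-! ## Cochains on the circulant torus with steps `3` and `1` -/

section Cochains

variable {q : ℕ} [NeZero q]

theorem fin_two_nsmul_of_odd {m : ℕ} (hm : Odd m) (a : Fin 2) : m • a = a := by
  obtain ⟨k, rfl⟩ := hm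
  rw [add_smul, one_smul, mul_comm, mul_smul, two_smul, fin_two_add_self, smul_zero, zero_add]

theorem zmod_const_of_succ {α : Type*} {g : ZMod q → α} (h : ∀ v, g (v + 1) = g v) (v : ZMod q) :
    g v = g 0 := by
  have key : ∀ k : ℕ, g (k : ZMod q) = g 0 := by
    intro k
    induction k with
    | zero => simp
    | succ k ih => rw [Nat.cast_succ, h, ih]
  simpa using key v.val

theorem sum_zmod_eq_sum_range {M : Type*} [AddCommMonoid M] (w : ZMod q → M) :
    ∑ v, w v = ∑ i ∈ Finset.range q, w (i : ZMod q) := by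
  symm
  refine Finset.sum_bij (fun i _ => (i : ZMod q)) (fun _ _ => Finset.mem_univ _) ?_ ?_
    fun _ _ => rfl
  · intro i hi j hj h
    rw [Finset.mem_range] at hi hj
    rw [← ZMod.val_cast_of_lt hi, ← ZMod.val_cast_of_lt hj, h]
  · intro v _
    exact ⟨v.val, Finset.mem_range.2 (ZMod.val_lt v), by simp⟩

theorem exists_primitive (w : ZMod q → Fin 2) (hw : ∑ v, w v = 0) :
    ∃ f : ZMod q → Fin 2, ∀ v, w v = f v + f (v + 1) := by
  refine ⟨fun v => ∑ i ∈ Finset.range v.val, w (i : ZMod q), fun v => ?_⟩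
  -- At `v = q - 1` the left sum is empty and the right one runs over all of `ZMod q`; only this
  -- wrap-around uses `hw`.
  have hs : ∑ i ∈ Finset.range (v + 1).val, w (i : ZMod q) =
      ∑ i ∈ Finset.range (v.val + 1), w (i : ZMod q) := by
    rcases (Nat.succ_le_of_lt (ZMod.val_lt v)).lt_or_eq with h | h
    · have : (v + 1).val = v.val + 1 := by
        conv_lhs => rw [← ZMod.natCast_zmod_val v, ← Nat.cast_succ]
        exact ZMod.val_cast_of_lt h
      rw [this]
    · have : v + 1 = 0 := by
        conv_lhs => rw [← ZMod.natCast_zmod_val v, ← Nat.cast_succ]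
        rw [h, ZMod.natCast_self]
      have h' : v.val + 1 = q := h
      rw [this, ZMod.val_zero, Finset.sum_range_zero, h', ← sum_zmod_eq_sum_range, hw]
  change w v = ∑ i ∈ Finset.range v.val, w (i : ZMod q) +
    ∑ i ∈ Finset.range (v + 1).val, w (i : ZMod q)
  rw [hs, Finset.sum_range_succ, ← add_assoc, fin_two_add_self, zero_add, ZMod.natCast_zmod_val]

theorem sum_shift {M : Type*} [AddCommMonoid M] (f : ZMod q → M) (a : ZMod q) :
    ∑ v, f (v + a) = ∑ v, f v :=
  Equiv.sum_comp (Equiv.addRight a) f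

/-- Steps of length `1` visit every vertex, so `w` alone determines a primitive `f` up to a
constant. Closedness then makes the discrepancy between `h` and the coboundary of `f` constant, and
its sum, an odd multiple of that constant, is zero. -/
theorem exact_of_closed (hq : Odd q) {h w : ZMod q → Fin 2}
    (hcl : ∀ c, h c + h (c + 1) + w c + w (c + 3) = 0) (hh : ∑ v, h v = 0) (hw : ∑ v, w v = 0) :
    ∃ f : ZMod q → Fin 2, (∀ v, h v = f v + f (v + 3)) ∧ ∀ v, w v = f v + f (v + 1) := by
  obtain ⟨f, hf⟩ := exists_primitive w hw
  refine ⟨f, fun v => ?_, hf⟩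
  have hconst : ∀ v, h (v + 1) + (f (v + 1) + f (v + 1 + 3)) = h v + (f v + f (v + 3)) := by
    intro v
    have e := hcl v
    rw [hf, hf, add_right_comm v 3 1] at e
    generalize h v = a at *; generalize h (v + 1) = b at *; generalize f v = c at *
    generalize f (v + 1) = d at *; generalize f (v + 3) = x at *
    generalize f (v + 1 + 3) = y at *
    revert a b c d x y; decide
  have hc := zmod_const_of_succ (g := fun v => h v + (f v + f (v + 3))) hconst
  have hsum : ∑ v, (h v + (f v + f (v + 3))) = 0 := by
    rw [Finset.sum_add_distrib, Finset.sum_add_distrib, hh, sum_shift, fin_two_add_self, add_zero]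
  rw [Finset.sum_congr rfl fun v _ => hc v, Finset.sum_const, Finset.card_univ, ZMod.card,
    fin_two_nsmul_of_odd hq] at hsum
  have := (hc v).trans hsum
  generalize h v = a at *; generalize f v = c at *; generalize f (v + 3) = x at *
  revert a c x; decide

/-! ### Weights of cochains and averaging over the translates of a loop. -/

/-- The number of nonzero values of a function. -/
def supportCard (h : ZMod q → Fin 2) : ℕ := (Finset.univ.filter fun v => h v ≠ 0).card

theorem supportCard_add_le (h w : ZMod q → Fin 2) :
    supportCard (fun v => h v + w v) ≤ supportCard h + supportCard w := by
  refine le_trans (Finset.card_le_card fun v => ?_) (Finset.card_union_le _ _)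
  simp only [Finset.mem_filter, Finset.mem_univ, true_and, Finset.mem_union]
  intro hv
  by_contra! hc
  exact hv (by rw [hc.1, hc.2, add_zero])

theorem supportCard_shift (h : ZMod q → Fin 2) (a : ZMod q) :
    supportCard (fun v => h (v + a)) = supportCard h :=
  Finset.card_equiv (Equiv.addRight a) fun v => by simp

theorem supportCard_sum_shift_le (h : ZMod q → Fin 2) (a : ℕ → ZMod q) (x : ℕ) :
    supportCard (fun v => ∑ i ∈ Finset.range x, h (v + a i)) ≤ x * supportCard h := by
  induction x with
  | zero => simp [supportCard]
  | succ x ih =>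
    simp only [Finset.sum_range_succ]
    refine (supportCard_add_le _ _).trans ?_
    rw [supportCard_shift, Nat.succ_mul]
    exact Nat.add_le_add_right ih _

theorem supportCard_single (a : ZMod q) : supportCard (Pi.single a (1 : Fin 2)) = 1 := by
  rw [supportCard, Finset.card_eq_one]
  refine ⟨a, ?_⟩
  ext v
  by_cases h : v = a
  · subst h; simp
  · simp [h]

theorem sum_sum_shift (h : ZMod q → Fin 2) (a : ℕ → ZMod q) (x : ℕ) :
    ∑ v, ∑ i ∈ Finset.range x, h (v + a i) = x • ∑ v, h v := by
  rw [Finset.sum_comm, Finset.sum_congr rfl fun i _ => sum_shift h (a i), Finset.sum_const,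
    Finset.card_range]

theorem sum_range_telescope (f : ℕ → Fin 2) (x : ℕ) :
    ∑ i ∈ Finset.range x, f i + ∑ i ∈ Finset.range x, f (i + 1) = f 0 + f x := by
  induction x with
  | zero => simp [fin_two_add_self]
  | succ x ih =>
    rw [Finset.sum_range_succ, Finset.sum_range_succ, add_add_add_comm, ih]
    generalize f 0 = a; generalize f x = b; generalize f (x + 1) = c
    revert a b c; decide

/-- `x` steps of length `3` from `v`, together with `y` steps of length `1` from `v + e`, make a
closed loop modulo `2`. -/
def IsLoop (q x y : ℕ) (e : ZMod q) : Prop :=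
  ∀ (f : ZMod q → Fin 2) (v : ZMod q), f v + f (v + 3 * x) = f (v + e) + f (v + e + y)

/-- The vertical run starts where the horizontal one ends, and returns to `v`. -/
theorem isLoop_of_add_eq_zero {q x y : ℕ} (h : 3 * (x : ZMod q) + y = 0) :
    IsLoop q x y (3 * x) := by
  intro f v
  rw [add_assoc v, h, add_zero, add_comm]

/-- Both runs lead from `v` to the same vertex; orientation does not matter modulo 2. -/
theorem isLoop_of_eq {q x y : ℕ} (h : 3 * (x : ZMod q) = y) : IsLoop q x y 0 := by
  intro f v
  rw [add_zero, h]

/-- This is the cochain dual to a loop: its `y` vertical steps become horizontal edges and its `x`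
horizontal steps become vertical ones. For a point mass `f` its weight is at most `x + y`, which
gives the short logical operator. -/
theorem loop_closed {x y : ℕ} {e : ZMod q} (hl : IsLoop q x y e) (f : ZMod q → Fin 2)
    (c : ZMod q) :
    ∑ j ∈ Finset.range y, f (c + (e + (j : ℕ))) + ∑ j ∈ Finset.range y, f (c + 1 + (e + (j : ℕ)))
      + ∑ i ∈ Finset.range x, f (c + 3 * (i : ℕ))
      + ∑ i ∈ Finset.range x, f (c + 3 + 3 * (i : ℕ)) = 0 := by
  have h1 := sum_range_telescope (fun j => f (c + (e + (j : ℕ)))) y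
  have h2 := sum_range_telescope (fun i => f (c + 3 * (i : ℕ))) x
  have e1 : ∀ j : ℕ, c + (e + ((j + 1 : ℕ) : ZMod q)) = c + 1 + (e + j) := by
    intro j; push_cast; ring
  have e2 : ∀ j : ℕ, c + 3 * ((j + 1 : ℕ) : ZMod q) = c + 3 + 3 * j := by
    intro j; push_cast; ring
  simp only [e1] at h1
  simp only [e2] at h2
  rw [h1, add_assoc, h2]
  have := hl f c
  simp only [Nat.cast_zero, add_zero, mul_zero, ← add_assoc]
  rw [add_assoc, this, fin_two_add_self]

theorem loop_sum_eq_zero (hq : Odd q) {h w : ZMod q → Fin 2}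
    (hcl : ∀ c, h c + h (c + 1) + w c + w (c + 3) = 0) {x y m : ℕ} {e : ZMod q}
    (hl : IsLoop q x y e) (hx : x ≤ m) (hy : y ≤ m)
    (hlt : m * (supportCard h + supportCard w) < q) :
    x • ∑ v, h v + y • ∑ v, w v = 0 := by
  set T : ZMod q → Fin 2 := fun v =>
    (∑ i ∈ Finset.range x, h (v + 3 * (i : ℕ))) + ∑ j ∈ Finset.range y, w (v + (e + (j : ℕ)))
    with hT
  have hsum : ∑ v, T v = x • ∑ v, h v + y • ∑ v, w v := by
    rw [hT, Finset.sum_add_distrib, sum_sum_shift h (fun i => 3 * (i : ℕ)),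
      sum_sum_shift w fun j => e + (j : ℕ)]
  -- `T v` is the sum of the cochain along the loop translated to `v`. Closedness, summed over the
  -- horizontal run, leaves only vertical edges at its two ends; by `hl` these cancel the change in
  -- the vertical run.
  have hstep : ∀ v, T (v + 1) = T v := by
    intro v
    have h1 : ∑ i ∈ Finset.range x, h (v + 3 * (i : ℕ)) +
        ∑ i ∈ Finset.range x, h (v + 1 + 3 * (i : ℕ)) + (w v + w (v + 3 * x)) = 0 := by
      have h2 := sum_range_telescope (fun i => w (v + 3 * (i : ℕ))) x
      simp only [Nat.cast_zero, mul_zero, add_zero] at h2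
      rw [← h2, ← Finset.sum_add_distrib, ← Finset.sum_add_distrib, ← Finset.sum_add_distrib]
      refine Finset.sum_eq_zero fun i _ => ?_
      have := hcl (v + 3 * (i : ℕ))
      rw [← add_assoc, add_right_comm v 1]
      have e2 : v + 3 * ((i + 1 : ℕ) : ZMod q) = v + 3 * i + 3 := by push_cast; ring
      rw [e2, this]
    have h3 := sum_range_telescope (fun j => w (v + (e + (j : ℕ)))) y
    have e1 : ∀ j : ℕ, v + (e + ((j + 1 : ℕ) : ZMod q)) = v + 1 + (e + j) := by
      intro j; push_cast; ring
    simp only [e1, Nat.cast_zero, add_zero] at h3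
    rw [← add_assoc v e, ← hl w v] at h3
    simp only [hT]
    revert h1 h3
    generalize w v + w (v + 3 * x) = a
    generalize ∑ i ∈ Finset.range x, h (v + 3 * (i : ℕ)) = b
    generalize ∑ i ∈ Finset.range x, h (v + 1 + 3 * (i : ℕ)) = c
    generalize ∑ j ∈ Finset.range y, w (v + (e + (j : ℕ))) = d
    generalize ∑ j ∈ Finset.range y, w (v + 1 + (e + (j : ℕ))) = f
    revert a b c d f
    decide
  have hc := zmod_const_of_succ hstep
  have h0 : ∑ v, T v = T 0 := by
    rw [Finset.sum_congr rfl fun v _ => hc v, Finset.sum_const, Finset.card_univ, ZMod.card,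
      fin_two_nsmul_of_odd hq]
  rw [← hsum, h0]
  by_contra hne
  -- If the constant value is nonzero, all `q` translates meet the support, too many for its size.
  have hfull : supportCard T = q := by
    have : (Finset.univ.filter fun v => T v ≠ 0) = Finset.univ :=
      Finset.filter_true_of_mem fun v _ => by rwa [hc v]
    rw [supportCard, this, Finset.card_univ, ZMod.card]
  have hle : supportCard T ≤ m * (supportCard h + supportCard w) := by
    refine (supportCard_add_le _ _).trans ?_
    rw [mul_add]
    exact add_le_add
      ((supportCard_sum_shift_le h (fun i => 3 * (i : ℕ)) x).trans (Nat.mul_le_mul_right _ hx))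
      ((supportCard_sum_shift_le w (fun j => e + (j : ℕ)) y).trans (Nat.mul_le_mul_right _ hy))
  omega

/-- Two independent loops, with at most `m` steps of each kind, where `m * k < q`. -/
def HasShortLoops (q k : ℕ) : Prop :=
  ∃ (m x y x' y' : ℕ) (e e' : ZMod q), IsLoop q x y e ∧ IsLoop q x' y' e' ∧
    x ≤ m ∧ y ≤ m ∧ x' ≤ m ∧ y' ≤ m ∧ m * k < q ∧ (x * y' + x' * y) % 2 = 1

theorem nsmul_fin_two (x : ℕ) (a : Fin 2) : x • a = if x % 2 = 1 then a else 0 := by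
  split_ifs with h
  · exact fin_two_nsmul_of_odd (Nat.odd_iff.2 h) a
  · obtain ⟨k, rfl⟩ := Nat.even_iff.2 (Nat.mod_two_ne_one.1 h)
    rw [add_smul, fin_two_add_self]

theorem exact_of_closed_of_small (hq : Odd q) {k : ℕ} (hk : HasShortLoops q k)
    {h w : ZMod q → Fin 2} (hcl : ∀ c, h c + h (c + 1) + w c + w (c + 3) = 0)
    (hlt : supportCard h + supportCard w ≤ k) :
    ∃ f : ZMod q → Fin 2, (∀ v, h v = f v + f (v + 3)) ∧ ∀ v, w v = f v + f (v + 1) := by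
  obtain ⟨m, x, y, x', y', e, e', hl, hl', hx, hy, hx', hy', hm, hdet⟩ := hk
  have hm' := (Nat.mul_le_mul_left m hlt).trans_lt hm
  have h1 := loop_sum_eq_zero hq hcl hl hx hy hm'
  have h2 := loop_sum_eq_zero hq hcl hl' hx' hy' hm'
  -- The two loops give a linear system modulo 2 in the two sums, with odd determinant.
  have h3 : ∑ v, h v = 0 ∧ ∑ v, w v = 0 := by
    rw [nsmul_fin_two, nsmul_fin_two] at h1 h2
    rw [Nat.add_mod, Nat.mul_mod, Nat.mul_mod x'] at hdet
    revert h1 h2 hdet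
    generalize ∑ v, h v = a
    generalize ∑ v, w v = b
    rcases Nat.mod_two_eq_zero_or_one x with h | h <;>
    rcases Nat.mod_two_eq_zero_or_one y with h' | h' <;>
    rcases Nat.mod_two_eq_zero_or_one x' with h'' | h'' <;>
    rcases Nat.mod_two_eq_zero_or_one y' with h''' | h''' <;>
    rw [h, h', h'', h'''] <;> revert a b <;> decide
  exact exact_of_closed hq hcl h3.1 h3.2

/-- The torus is self-dual: `v ↦ -v` together with exchanging horizontal and vertical turns coclosed
cochains into closed ones and preserves the weight. -/
theorem exact_of_coclosed_of_small (hq : Odd q) {k : ℕ} (hk : HasShortLoops q k)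
    {h w : ZMod q → Fin 2} (hcl : ∀ c, h c + h (c - 3) + w c + w (c - 1) = 0)
    (hlt : supportCard h + supportCard w ≤ k) :
    ∃ g : ZMod q → Fin 2, (∀ v, h v = g v + g (v - 1)) ∧ ∀ v, w v = g v + g (v - 3) := by
  have hneg : ∀ f : ZMod q → Fin 2, supportCard (fun v => f (-v)) = supportCard f := fun f =>
    Finset.card_equiv (Equiv.neg _) fun v => by simp
  obtain ⟨f, hf₁, hf₂⟩ := exact_of_closed_of_small hq hk (h := fun v => w (-v))
    (w := fun v => h (-v)) (fun c => by
      have := hcl (-c)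
      rw [neg_add, neg_add, ← sub_eq_add_neg, ← sub_eq_add_neg, ← this]; abel)
    (by rw [hneg, hneg, add_comm]; exact hlt)
  refine ⟨fun v => f (-v), fun v => ?_, fun v => ?_⟩
  · have := hf₂ (-v)
    rw [neg_neg] at this
    change h v = f (-v) + f (-(v - 1))
    rw [this, neg_sub, sub_eq_neg_add]
  · have := hf₁ (-v)
    rw [neg_neg] at this
    change w v = f (-v) + f (-(v - 3))
    rw [this, neg_sub, sub_eq_neg_add]

end Cochains

/-! ## The code of the circulant torus -/

section Torus

variable {q : ℕ} [NeZero q] {ι : Type*} [Fintype ι] [DecidableEq ι] (e : ι ≃ Fin 2 × ZMod q)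

/-- The horizontal part of a bit vector on the edges. -/
def hPart (s : ι → Fin 2) (v : ZMod q) : Fin 2 := s (e.symm (0, v))

/-- The vertical part of a bit vector on the edges. -/
def vPart (s : ι → Fin 2) (v : ZMod q) : Fin 2 := s (e.symm (1, v))

/-- The bit vector on the edges with given horizontal and vertical parts. -/
def ofHV (h w : ZMod q → Fin 2) : ι → Fin 2 :=
  fun j => if (e j).1 = 0 then h (e j).2 else w (e j).2

variable {e} in
theorem ext_hv {s t : ι → Fin 2} (h : ∀ v, hPart e s v = hPart e t v)
    (w : ∀ v, vPart e s v = vPart e t v) : s = t := by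
  funext j
  obtain ⟨⟨i, v⟩, rfl⟩ := e.symm.surjective j
  fin_cases i
  · exact h v
  · exact w v

@[simp] theorem hPart_ofHV (h w : ZMod q → Fin 2) (v : ZMod q) :
    hPart e (ofHV e h w) v = h v := by
  simp [hPart, ofHV]

@[simp] theorem vPart_ofHV (h w : ZMod q → Fin 2) (v : ZMod q) :
    vPart e (ofHV e h w) v = w v := by
  simp [vPart, ofHV]

theorem sum_hv {M : Type*} [AddCommMonoid M] (F : ι → M) :
    ∑ j, F j = ∑ v, F (e.symm (0, v)) + ∑ v, F (e.symm (1, v)) := by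
  rw [← Equiv.sum_comp e.symm, Fintype.sum_prod_type, Fin.sum_univ_two]

theorem bitWeight_eq (s : ι → Fin 2) :
    bitWeight s = supportCard (hPart e s) + supportCard (vPart e s) := by
  simp only [bitWeight, supportCard, Finset.card_filter]
  exact sum_hv e _

/-- The coboundary of a function on the vertices. -/
def grad : (ZMod q → Fin 2) →+ (ι → Fin 2) where
  toFun f := ofHV e (fun v => f v + f (v + 3)) fun v => f v + f (v + 1)
  map_zero' := ext_hv (e := e) (fun v => by simp; rfl) fun v => by simp; rfl
  map_add' f g := by
    funext j
    simp only [ofHV, Pi.add_apply]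
    split_ifs <;> abel

/-- The boundary of a function on the faces. -/
def bdry : (ZMod q → Fin 2) →+ (ι → Fin 2) where
  toFun f := ofHV e (fun v => f v + f (v - 1)) fun v => f v + f (v - 3)
  map_zero' := ext_hv (e := e) (fun v => by simp; rfl) fun v => by simp; rfl
  map_add' f g := by
    funext j
    simp only [ofHV, Pi.add_apply]
    split_ifs <;> abel

theorem grad_apply (f : ZMod q → Fin 2) :
    grad e f = ofHV e (fun v => f v + f (v + 3)) fun v => f v + f (v + 1) := rfl

theorem bdry_apply (g : ZMod q → Fin 2) :
    bdry e g = ofHV e (fun v => g v + g (v - 1)) fun v => g v + g (v - 3) := rfl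

theorem dotProduct_eq (s t : ι → Fin 2) :
    s ⬝ᵥ t = ∑ v, hPart e s v * hPart e t v + ∑ v, vPart e s v * vPart e t v :=
  sum_hv e _

/-- Summation by parts moves the boundary operator from `g` to a coboundary on `s`. -/
theorem bdry_dotProduct (g : ZMod q → Fin 2) (s : ι → Fin 2) :
    bdry e g ⬝ᵥ s = ∑ v, g v *
      (hPart e s v + hPart e s (v + 1) + vPart e s v + vPart e s (v + 3)) := by
  have h1 : ∑ v, g (v - 1) * hPart e s v = ∑ v, g v * hPart e s (v + 1) := by
    rw [← sum_shift _ 1]; simp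
  have h3 : ∑ v, g (v - 3) * vPart e s v = ∑ v, g v * vPart e s (v + 3) := by
    rw [← sum_shift _ 3]; simp
  rw [dotProduct_eq e]
  simp only [bdry_apply, hPart_ofHV, vPart_ofHV, add_mul, mul_add,
    Finset.sum_add_distrib, h1, h3]
  abel

theorem dotProduct_grad (f : ZMod q → Fin 2) (s : ι → Fin 2) :
    s ⬝ᵥ grad e f = ∑ v, f v *
      (hPart e s v + hPart e s (v - 3) + vPart e s v + vPart e s (v - 1)) := by
  have h1 : ∑ v, vPart e s v * f (v + 1) = ∑ v, vPart e s (v - 1) * f v := by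
    rw [← sum_shift (fun v => vPart e s (v - 1) * f v) 1]; simp
  have h3 : ∑ v, hPart e s v * f (v + 3) = ∑ v, hPart e s (v - 3) * f v := by
    rw [← sum_shift (fun v => hPart e s (v - 3) * f v) 3]; simp
  rw [dotProduct_eq e]
  simp only [grad_apply, hPart_ofHV, vPart_ofHV, mul_add,
    Finset.sum_add_distrib, h1, h3]
  simp only [mul_comm]
  abel

theorem bdry_orthogonal_iff (s : ι → Fin 2) :
    (∀ b ∈ (bdry e).range, b ⬝ᵥ s = 0) ↔
      ∀ c, hPart e s c + hPart e s (c + 1) + vPart e s c + vPart e s (c + 3) = 0 := by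
  constructor
  · intro h c
    have := h _ ⟨Pi.single c 1, rfl⟩
    rw [bdry_dotProduct] at this
    simpa [Pi.single_apply] using this
  · rintro h _ ⟨g, rfl⟩
    rw [bdry_dotProduct]
    exact Finset.sum_eq_zero fun v _ => by rw [h, mul_zero]

theorem grad_orthogonal_iff (s : ι → Fin 2) :
    (∀ a ∈ (grad e).range, s ⬝ᵥ a = 0) ↔
      ∀ c, hPart e s c + hPart e s (c - 3) + vPart e s c + vPart e s (c - 1) = 0 := by
  constructor
  · intro h c
    have := h _ ⟨Pi.single c 1, rfl⟩
    rw [dotProduct_grad] at this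
    simpa [Pi.single_apply] using this
  · rintro h _ ⟨g, rfl⟩
    rw [dotProduct_grad]
    exact Finset.sum_eq_zero fun v _ => by rw [h, mul_zero]

theorem bdry_dotProduct_grad :
    ∀ a ∈ (grad e).range, ∀ b ∈ (bdry e).range, b ⬝ᵥ a = 0 := by
  rintro _ ⟨f, rfl⟩
  rw [bdry_orthogonal_iff]
  intro c
  simp only [grad_apply, hPart_ofHV, vPart_ofHV]
  rw [add_right_comm c 1 3]
  generalize f c = x; generalize f (c + 3) = y; generalize f (c + 1) = z
  generalize f (c + 3 + 1) = t
  revert x y z t; decide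

/-- The class of a bit vector in the first cohomology group. -/
def cohClass : (ι → Fin 2) →+ Fin 2 × Fin 2 where
  toFun s := (∑ v, hPart e s v, ∑ v, vPart e s v)
  map_zero' := by simp [hPart, vPart]
  map_add' s t := by simp [hPart, vPart, Finset.sum_add_distrib]

theorem cohClass_apply (s : ι → Fin 2) :
    cohClass e s = (∑ v, hPart e s v, ∑ v, vPart e s v) := rfl

theorem cohClass_eq_zero_iff (hq : Odd q) (s : ι → Fin 2)
    (hs : ∀ b ∈ (bdry e).range, b ⬝ᵥ s = 0) : cohClass e s = 0 ↔ s ∈ (grad e).range := by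
  constructor
  · intro h
    obtain ⟨f, hf₁, hf₂⟩ := exact_of_closed hq ((bdry_orthogonal_iff e s).1 hs)
      (congrArg Prod.fst h) (congrArg Prod.snd h)
    exact ⟨f, ext_hv (e := e) (fun v => by simp [grad_apply, hf₁]) fun v => by simp [grad_apply, hf₂]⟩
  · rintro ⟨f, rfl⟩
    simp [cohClass_apply, grad_apply, Finset.sum_add_distrib, sum_shift, fin_two_add_self]

/-- The toric code of the circulant torus with an odd number `q` of cells. -/
theorem hasParameters_torus (hq : Odd q) {d x y : ℕ} {a : ZMod q} (hloops : HasShortLoops q (d - 1))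
    (hl : IsLoop q x y a) (hd : x + y = d) (hodd : ¬ (x % 2 = 0 ∧ y % 2 = 0)) :
    HasParameters (cssCode (grad e).range (bdry e).range) (2 * q) 2 d := by
  refine hasParameters_cssCode (cl := cohClass e) ?_ (by simp) (bdry_dotProduct_grad e)
    (cohClass_eq_zero_iff e hq) ?_ ?_ ?_ ?_
  · rw [Fintype.card_congr e, Fintype.card_prod, Fintype.card_fin, ZMod.card]
  · rintro ⟨κ, μ⟩
    -- Constant cochains are closed, and since `q` is odd they realize every class.
    refine ⟨ofHV e (fun _ => κ) fun _ => μ, ?_, ?_⟩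
    · rw [bdry_orthogonal_iff]
      intro c
      simp only [hPart_ofHV, vPart_ofHV]
      rw [fin_two_add_self, zero_add, fin_two_add_self]
    · simp only [cohClass_apply, hPart_ofHV, vPart_ofHV,
        Finset.sum_const, Finset.card_univ, ZMod.card, fin_two_nsmul_of_odd hq]
  · intro s hs hlt
    rw [bitWeight_eq e] at hlt
    obtain ⟨f, hf₁, hf₂⟩ := exact_of_closed_of_small hq hloops ((bdry_orthogonal_iff e s).1 hs)
      (Nat.le_sub_one_of_lt hlt)
    exact ⟨f, ext_hv (e := e) (fun v => by simp [grad_apply, hf₁]) fun v => by simp [grad_apply, hf₂]⟩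
  · intro s hs hlt
    rw [bitWeight_eq e] at hlt
    obtain ⟨f, hf₁, hf₂⟩ := exact_of_coclosed_of_small hq hloops
      ((grad_orthogonal_iff e s).1 hs) (Nat.le_sub_one_of_lt hlt)
    exact ⟨f, ext_hv (e := e) (fun v => by simp [bdry_apply, hf₁]) fun v => by simp [bdry_apply, hf₂]⟩
  · set δ : ZMod q → Fin 2 := Pi.single 0 1 with hδ
    have hs : ∑ v, δ v = 1 := by simp [hδ]
    refine ⟨ofHV e (fun c => ∑ j ∈ Finset.range y, δ (c + (a + (j : ℕ))))
      (fun c => ∑ i ∈ Finset.range x, δ (c + 3 * (i : ℕ))), ?_, ?_, ?_⟩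
    · rw [bdry_orthogonal_iff]
      intro c
      simp only [hPart_ofHV, vPart_ofHV]
      exact loop_closed hl δ c
    · intro h0
      have h1 := congrArg Prod.fst h0
      have h2 := congrArg Prod.snd h0
      simp only [cohClass_apply, hPart_ofHV, vPart_ofHV,
        Prod.fst_zero, Prod.snd_zero] at h1 h2
      rw [sum_sum_shift δ (fun j => a + (j : ℕ)), hs, nsmul_fin_two] at h1
      rw [sum_sum_shift δ (fun i => 3 * (i : ℕ)), hs, nsmul_fin_two] at h2
      refine hodd ⟨?_, ?_⟩
      · by_contra h
        rw [if_pos (Nat.mod_two_ne_zero.1 h)] at h2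
        exact absurd h2 (by decide)
      · by_contra h
        rw [if_pos (Nat.mod_two_ne_zero.1 h)] at h1
        exact absurd h1 (by decide)
    · rw [bitWeight_eq e, ← hd, add_comm x]
      have h1 := supportCard_sum_shift_le δ (fun j => a + (j : ℕ)) y
      have h2 := supportCard_sum_shift_le δ (fun i => 3 * (i : ℕ)) x
      rw [hδ, supportCard_single, mul_one] at h1 h2
      refine add_le_add (le_trans (le_of_eq ?_) h1) (le_trans (le_of_eq ?_) h2)
      · exact congrArg supportCard (funext fun v => hPart_ofHV e _ _ v)
      · exact congrArg supportCard (funext fun v => vPart_ofHV e _ _ v)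

end Torus

/-! ## The toric code of a tessellation as a code on the circulant torus -/

section Tessellation

/-- Reduces invariance under a whole range of `grad` or `bdry` to the operators of single vertices
or faces. -/
theorem mem_of_single_mem {V M : Type*} [Fintype V] [DecidableEq V] [AddCommGroup M]
    (G : (V → Fin 2) →+ M) (K : AddSubgroup M) (h : ∀ u, G (Pi.single u 1) ∈ K)
    (f : V → Fin 2) : G f ∈ K := by
  rw [← Finset.univ_sum_single f, map_sum]
  refine sum_mem fun u _ => ?_
  by_cases hu : f u = 0
  · rw [hu, Pi.single_zero, map_zero]
    exact zero_mem _
  · rw [fin_two_eq_one_of_ne_zero hu]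
    exact h u

theorem pauliOp_ite_X {ι : Type*} [Fintype ι] [DecidableEq ι] (p : ι → Prop) [DecidablePred p] :
    pauliOp (fun j => if p j then Pauli.X else Pauli.I) =
      weyl (fun j => if p j then 1 else 0) 0 := by
  rw [pauliOp_eq_weyl]
  have h₀ : ∀ j, (if p j then Pauli.X else Pauli.I).phase = 0 := fun j => by split_ifs <;> rfl
  have h₁ : ∀ j, (if p j then Pauli.X else Pauli.I).xPart = if p j then 1 else 0 :=
    fun j => by split_ifs <;> rfl
  have h₂ : ∀ j, (if p j then Pauli.X else Pauli.I).zPart = 0 := fun j => by split_ifs <;> rfl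
  simp only [h₀, h₁, h₂, Finset.sum_const_zero, pow_zero, one_smul]
  rfl

theorem pauliOp_ite_Z {ι : Type*} [Fintype ι] [DecidableEq ι] (p : ι → Prop) [DecidablePred p] :
    pauliOp (fun j => if p j then Pauli.Z else Pauli.I) =
      weyl 0 (fun j => if p j then 1 else 0) := by
  rw [pauliOp_eq_weyl]
  have h₀ : ∀ j, (if p j then Pauli.Z else Pauli.I).phase = 0 := fun j => by split_ifs <;> rfl
  have h₁ : ∀ j, (if p j then Pauli.Z else Pauli.I).zPart = if p j then 1 else 0 :=
    fun j => by split_ifs <;> rfl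
  have h₂ : ∀ j, (if p j then Pauli.Z else Pauli.I).xPart = 0 := fun j => by split_ifs <;> rfl
  simp only [h₀, h₁, h₂, Finset.sum_const_zero, pow_zero, one_smul]
  rfl

variable {q : ℕ} [NeZero q] {A : AddSubgroup (ZMod q × ZMod q)}

/-- The homomorphism `(x, y) ↦ 3 x + y`. -/
def slope (q : ℕ) : ZMod q × ZMod q →+ ZMod q where
  toFun a := 3 * a.1 + a.2
  map_zero' := by simp
  map_add' a b := by simp only [Prod.fst_add, Prod.snd_add]; ring

/-- The positions modulo the kernel of `slope` are the elements of `ZMod q`. -/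
def posEquiv (hA : A = (slope q).ker) : Pos A ≃+ ZMod q :=
  (QuotientAddGroup.quotientAddEquivOfEq hA).trans
    (QuotientAddGroup.quotientKerEquivOfSurjective (slope q) fun y => ⟨(0, y), by simp [slope]⟩)

theorem posEquiv_mk (hA : A = (slope q).ker) (a : ZMod q × ZMod q) :
    posEquiv hA (QuotientAddGroup.mk a) = 3 * a.1 + a.2 := rfl

theorem posEquiv_stepH (hA : A = (slope q).ker) : posEquiv hA (stepH A) = 3 := by
  rw [stepH, posEquiv_mk]; simp

theorem posEquiv_stepV (hA : A = (slope q).ker) : posEquiv hA (stepV A) = 1 := by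
  rw [stepV, posEquiv_mk]; simp

variable {P : Finset (ℤ × ℤ)}

/-- Only the covering half of the tiling condition matters here; it makes all edges and vertices of
the quotient torus occur in `P`. -/
theorem IsTessellation.exists_pos_eq (hP : IsTessellation A P) (v : Pos A) :
    ∃ c ∈ P, pos A c = v := by
  obtain ⟨x, rfl⟩ := QuotientAddGroup.mk_surjective v
  obtain ⟨⟨c, a⟩, h, -⟩ := hP.tiles x
  refine ⟨c, c.2, ?_⟩
  rw [pos, QuotientAddGroup.eq, ← h]
  simp

theorem IsTessellation.mem_polyominoEdges (hP : IsTessellation A P) (e : Fin 2 × Pos A) :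
    e ∈ polyominoEdges A P := by
  obtain ⟨c, hc, h⟩ := hP.exists_pos_eq e.2
  refine Finset.mem_biUnion.2 ⟨c, hc, ?_⟩
  obtain ⟨i, v⟩ := e
  fin_cases i <;> simp [cellEdges, h]

theorem IsTessellation.mem_polyominoVertices (hP : IsTessellation A P) (v : Pos A) :
    v ∈ polyominoVertices A P := by
  obtain ⟨c, hc, h⟩ := hP.exists_pos_eq v
  exact Finset.mem_biUnion.2 ⟨c, hc, by simp [cellCorners, h]⟩

/-- The edges of a tessellation are the edges of the circulant torus. -/
def edgeEquiv (hA : A = (slope q).ker) (hP : IsTessellation A P) :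
    polyominoEdges A P ≃ Fin 2 × ZMod q :=
  (Equiv.subtypeUnivEquiv hP.mem_polyominoEdges).trans
    (Equiv.prodCongr (Equiv.refl _) (posEquiv hA).toEquiv)

theorem coe_edgeEquiv_symm (hA : A = (slope q).ker) (hP : IsTessellation A P) (i : Fin 2)
    (v : ZMod q) : (((edgeEquiv hA hP).symm (i, v) : polyominoEdges A P) : Fin 2 × Pos A) =
      (i, (posEquiv hA).symm v) := rfl

theorem single_add_single {a b u : ZMod q} (h : a ≠ b) :
    (Pi.single u 1 : ZMod q → Fin 2) a + (Pi.single u 1 : ZMod q → Fin 2) b =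
      if u = a ∨ u = b then 1 else 0 := by
  simp only [Pi.single_apply]
  by_cases ha : u = a
  · subst ha
    simp [h.symm]
  · by_cases hb : u = b
    · subst hb
      simp [h]
    · simp [ha, hb, Ne.symm ha, Ne.symm hb]

/-- `h1` and `h3` exclude edges with equal ends, on which the coboundary would cancel modulo 2 while
the vertex operator would not. -/
theorem vertexOp_eq (hA : A = (slope q).ker) (hP : IsTessellation A P) (h1 : (1 : ZMod q) ≠ 0)
    (h3 : (3 : ZMod q) ≠ 0) (v : Pos A) :
    vertexOp A P v = weyl (grad (edgeEquiv hA hP) (Pi.single (posEquiv hA v) 1)) 0 := by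
  rw [vertexOp, pauliOp_ite_X, grad_apply]
  congr 1
  refine ext_hv (e := edgeEquiv hA hP) (fun u => ?_) fun u => ?_
  · rw [hPart_ofHV, single_add_single (by simpa using h3), hPart, coe_edgeEquiv_symm]
    refine if_congr ?_ rfl rfl
    simp only [edgeEnds, if_true, Finset.mem_insert, Finset.mem_singleton]
    rw [← (posEquiv hA).apply_eq_iff_eq (x := v), ← (posEquiv hA).apply_eq_iff_eq (x := v),
      map_add, AddEquiv.apply_symm_apply, posEquiv_stepH]
  · rw [vPart_ofHV, single_add_single (by simpa using h1), vPart, coe_edgeEquiv_symm]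
    refine if_congr ?_ rfl rfl
    simp only [edgeEnds, one_ne_zero, if_false, Finset.mem_insert, Finset.mem_singleton]
    rw [← (posEquiv hA).apply_eq_iff_eq (x := v), ← (posEquiv hA).apply_eq_iff_eq (x := v),
      map_add, AddEquiv.apply_symm_apply, posEquiv_stepV]

theorem faceOp_eq (hA : A = (slope q).ker) (hP : IsTessellation A P) (h1 : (1 : ZMod q) ≠ 0)
    (h3 : (3 : ZMod q) ≠ 0) (c : Pos A) :
    faceOp A P c = weyl 0 (bdry (edgeEquiv hA hP) (Pi.single (posEquiv hA c) 1)) := by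
  rw [faceOp, pauliOp_ite_Z, bdry_apply]
  congr 1
  refine ext_hv (e := edgeEquiv hA hP) (fun u => ?_) fun u => ?_
  · rw [hPart_ofHV, single_add_single (by simpa [sub_eq_iff_eq_add, eq_sub_iff_add_eq] using h1),
      hPart, coe_edgeEquiv_symm]
    refine if_congr ?_ rfl rfl
    simp only [cellEdges, Finset.mem_insert, Finset.mem_singleton, Prod.mk.injEq, true_and,
      zero_ne_one, false_and, or_false]
    rw [← (posEquiv hA).apply_eq_iff_eq, ← (posEquiv hA).apply_eq_iff_eq (y := c + stepV A),
      map_add, AddEquiv.apply_symm_apply, posEquiv_stepV, eq_sub_iff_add_eq, eq_comm,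
      eq_comm (a := u) (b := _ + 1)]
  · rw [vPart_ofHV, single_add_single (by simpa [sub_eq_iff_eq_add, eq_sub_iff_add_eq] using h3),
      vPart, coe_edgeEquiv_symm]
    refine if_congr ?_ rfl rfl
    simp only [cellEdges, Finset.mem_insert, Finset.mem_singleton, Prod.mk.injEq, true_and,
      one_ne_zero, false_and, false_or]
    rw [← (posEquiv hA).apply_eq_iff_eq, ← (posEquiv hA).apply_eq_iff_eq (y := c + stepH A),
      map_add, AddEquiv.apply_symm_apply, posEquiv_stepH, eq_sub_iff_add_eq, eq_comm,
      eq_comm (a := u) (b := _ + 3)]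

theorem toricCode_eq_cssCode (hA : A = (slope q).ker) (hP : IsTessellation A P)
    (h1 : (1 : ZMod q) ≠ 0) (h3 : (3 : ZMod q) ≠ 0) :
    toricCode A P =
      cssCode (grad (edgeEquiv hA hP)).range (bdry (edgeEquiv hA hP)).range := by
  ext ψ
  constructor
  · rintro ⟨hv, hf⟩
    constructor
    · let K : AddSubgroup (polyominoEdges A P → Fin 2) :=
        { carrier := {a | ∀ s, ψ (s + a) = ψ s}
          zero_mem' := fun s => by rw [add_zero]
          add_mem' := fun {a b} ha hb s => by rw [← add_assoc, hb, ha]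
          neg_mem' := fun {a} ha s => by rw [pi_fin_two_neg]; exact ha s }
      rintro _ ⟨f, rfl⟩
      refine mem_of_single_mem _ K (fun u s => ?_) f
      have := hv _ (hP.mem_polyominoVertices ((posEquiv hA).symm u))
      rw [vertexOp_eq hA hP h1 h3, AddEquiv.apply_symm_apply] at this
      simpa [weyl_mulVec] using congrFun this s
    · let K : AddSubgroup (polyominoEdges A P → Fin 2) :=
        { carrier := {b | ∀ s, sgn (b ⬝ᵥ s) * ψ s = ψ s}
          zero_mem' := fun s => by rw [zero_dotProduct, sgn_zero, one_mul]
          add_mem' := fun {a b} ha hb s => by rw [add_dotProduct, sgn_add, mul_assoc, hb, ha]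
          neg_mem' := fun {a} ha s => by rw [pi_fin_two_neg]; exact ha s }
      rintro _ ⟨f, rfl⟩
      refine mem_of_single_mem _ K (fun u s => ?_) f
      obtain ⟨c, hc, h⟩ := hP.exists_pos_eq ((posEquiv hA).symm u)
      have := hf c hc
      rw [h, faceOp_eq hA hP h1 h3, AddEquiv.apply_symm_apply] at this
      simpa [weyl_mulVec] using congrFun this s
  · rintro ⟨hv, hf⟩
    constructor
    · intro v _
      ext s
      rw [vertexOp_eq hA hP h1 h3, weyl_mulVec, zero_dotProduct, sgn_zero, one_mul,
        hv _ ⟨_, rfl⟩]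
    · intro c _
      ext s
      rw [faceOp_eq hA hP h1 h3, weyl_mulVec, add_zero, hf _ ⟨_, rfl⟩]

end Tessellation

/-! ## The codes generated by `(1, 2n - 2)` -/

theorem cyclicCode_eq_ker {n q : ℕ} (hq : q = 2 * n + 1) :
    cyclicCode q (2 * n - 2) = (slope q).ker := by
  have hg : ((2 * n - 2 : ℤ) : ZMod q) = -3 := by
    have : ((2 * n + 1 : ℕ) : ZMod q) = 0 := by rw [← hq, ZMod.natCast_self]
    push_cast at this ⊢
    linear_combination this
  ext ⟨x, y⟩
  rw [cyclicCode, AddSubgroup.mem_zmultiples_iff, hg, AddMonoidHom.mem_ker]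
  change _ ↔ 3 * x + y = 0
  constructor
  · rintro ⟨k, hk⟩
    simp only [Prod.smul_mk, Prod.mk.injEq, zsmul_eq_mul, mul_one] at hk
    rw [← hk.1, ← hk.2]
    ring
  · intro h
    obtain ⟨k, rfl⟩ := ZMod.intCast_surjective x
    refine ⟨k, ?_⟩
    simp only [Prod.smul_mk, Prod.mk.injEq, zsmul_eq_mul, mul_one, true_and]
    linear_combination -h

/-- A vertical bar of `q` cells works: `slope` takes each value exactly once on it, so it is a
transversal of `A`. -/
theorem exists_isTessellation {q : ℕ} [NeZero q] {A : AddSubgroup (ZMod q × ZMod q)}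
    (hA : A = (slope q).ker) : ∃ P : Finset (ℤ × ℤ), IsTessellation A P := by
  have hinj : Function.Injective fun i : ℕ => ((0, i) : ℤ × ℤ) := fun i j h => by
    simpa using h
  have hmem : ∀ x, x ∈ A ↔ 3 * x.1 + x.2 = 0 := fun x => by rw [hA]; rfl
  refine ⟨(Finset.range q).map ⟨_, hinj⟩, ?_, by simp, fun x => ?_⟩
  · rw [IsPolyomino, SimpleGraph.connected_iff_exists_forall_reachable]
    have hm : ∀ i : ℕ, i < q → ((0, i) : ℤ × ℤ) ∈
        (((Finset.range q).map ⟨_, hinj⟩ : Finset (ℤ × ℤ)) : Set (ℤ × ℤ)) := by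
      intro i hi
      simpa using hi
    have hr : ∀ (i : ℕ) (hi : i < q), (cellGraph.induce _).Reachable
        ⟨_, hm 0 (NeZero.pos q)⟩ ⟨_, hm i hi⟩ := by
      intro i
      induction i with
      | zero => exact fun _ => SimpleGraph.Reachable.refl _
      | succ i ih =>
        intro hi
        refine (ih (Nat.lt_of_succ_lt hi)).trans (SimpleGraph.Adj.reachable ?_)
        change |(0 : ℤ) - 0| + |(i : ℤ) - ((i + 1 : ℕ) : ℤ)| = 1
        simp
    refine ⟨⟨_, hm 0 (NeZero.pos q)⟩, ?_⟩
    rintro ⟨c, hc⟩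
    obtain ⟨i, hi, rfl⟩ := Finset.mem_map.1 (Finset.mem_coe.1 hc)
    exact hr i (Finset.mem_range.1 hi)
  · have hm : ((0, ((3 * x.1 + x.2).val : ℤ)) : ℤ × ℤ) ∈ (Finset.range q).map ⟨_, hinj⟩ :=
      Finset.mem_map.2 ⟨_, Finset.mem_range.2 (ZMod.val_lt _), rfl⟩
    refine ⟨⟨⟨_, hm⟩, ⟨x - cellMod q (0, ((3 * x.1 + x.2).val : ℤ)), ?_⟩⟩,
      add_sub_cancel _ _, ?_⟩
    · rw [hmem]
      simp only [cellMod, Prod.fst_sub, Prod.snd_sub, Int.cast_zero, Int.cast_natCast,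
        ZMod.natCast_zmod_val]
      ring
    · rintro ⟨⟨c, hc⟩, ⟨a, ha⟩⟩ h
      obtain ⟨i, hi, rfl⟩ := Finset.mem_map.1 hc
      have h' : cellMod q (0, (i : ℤ)) + a = x := h
      rw [hmem] at ha
      have hi' : (3 * x.1 + x.2).val = i := by
        have : 3 * x.1 + x.2 = (i : ZMod q) := by
          rw [← h']
          simp only [cellMod, Prod.fst_add, Prod.snd_add, Int.cast_zero, Int.cast_natCast]
          linear_combination ha
        rw [this, ZMod.val_cast_of_lt (Finset.mem_range.1 hi)]
      rw [Prod.mk.injEq]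
      refine ⟨Subtype.ext ?_, Subtype.ext ?_⟩
      · change ((0, (i : ℤ)) : ℤ × ℤ) = (0, _)
        rw [hi']
      · change a = x - _
        rw [hi', ← h', add_sub_cancel_left]

/-- Passes to integer vectors: `hx` and `hy` say that `x` and `y` are already absolutely least
residues, so the witness has weight `d` exactly. -/
theorem isMinMannheim_of {q : ℕ} [NeZero q] {A : AddSubgroup (ZMod q × ZMod q)}
    (hA : A = (slope q).ker) {d : ℕ}
    (hlow : ∀ x y : ℤ, (q : ℤ) ∣ 3 * x + y → |x| + |y| < d → x = 0 ∧ y = 0) {x y : ℤ}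
    (hx : x * 2 ∈ Set.Ioc (-(q : ℤ)) q) (hy : y * 2 ∈ Set.Ioc (-(q : ℤ)) q)
    (hxy : (q : ℤ) ∣ 3 * x + y) (hd : x.natAbs + y.natAbs = d) (hx0 : x ≠ 0) :
    IsMinMannheim A d := by
  have hmem : ∀ a, a ∈ A ↔ 3 * a.1 + a.2 = 0 := fun a => by rw [hA]; rfl
  have hvx : (x : ZMod q).valMinAbs = x := (ZMod.valMinAbs_spec _ _).2 ⟨rfl, hx⟩
  have hvy : (y : ZMod q).valMinAbs = y := (ZMod.valMinAbs_spec _ _).2 ⟨rfl, hy⟩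
  refine ⟨⟨((x : ZMod q), (y : ZMod q)), ?_, ?_, ?_⟩, ?_⟩
  · rw [hmem]
    have := (ZMod.intCast_zmod_eq_zero_iff_dvd _ q).2 hxy
    push_cast at this
    exact this
  · intro h
    have := congrArg (fun a => ZMod.valMinAbs (Prod.fst a)) h
    simp only [hvx, Prod.fst_zero, ZMod.valMinAbs_zero] at this
    exact hx0 this
  · rw [mannheimWeight, hvx, hvy, hd]
  · rintro w ⟨⟨a, b⟩, hab, h0, rfl⟩
    by_contra! hlt
    rw [hmem] at hab
    have := hlow a.valMinAbs b.valMinAbs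
      ((ZMod.intCast_zmod_eq_zero_iff_dvd _ q).1 (by
        push_cast [ZMod.coe_valMinAbs]
        exact hab))
      (by rw [mannheimWeight] at hlt; zify at hlt; exact hlt)
    rw [ZMod.valMinAbs_eq_zero, ZMod.valMinAbs_eq_zero] at this
    exact h0 (Prod.ext this.1 this.2)

theorem isMinMannheim_cyclicCode {n q : ℕ} (hn : 2 ≤ n) (hq : q = 2 * n + 1) :
    IsMinMannheim (cyclicCode q (2 * n - 2)) (if n ≤ 4 then 3 else 4) := by
  have : NeZero q := ⟨by omega⟩
  have hA := cyclicCode_eq_ker hq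
  split_ifs with h
  · have h' : n = 2 ∨ n = 3 ∨ n = 4 := by omega
    have hlow : ∀ x y : ℤ, (q : ℤ) ∣ 3 * x + y → |x| + |y| < (3 : ℕ) → x = 0 ∧ y = 0 := by
      rintro x y ⟨k, hk⟩ hlt
      have hx := abs_lt.1 (show |x| < 3 by have := abs_nonneg y; push_cast at hlt; linarith)
      rcases h' with rfl | rfl | rfl <;> subst hq <;> push_cast at hk hlt <;>
        rcases abs_cases x with ⟨e, _⟩ | ⟨e, _⟩ <;> rcases abs_cases y with ⟨e', _⟩ | ⟨e', _⟩ <;>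
        rw [e, e'] at hlt <;> clear e e' <;> obtain ⟨hx₁, hx₂⟩ := hx <;> interval_cases x <;>
        omega
    rcases h' with rfl | rfl | rfl <;> subst hq
    · exact isMinMannheim_of hA hlow (x := 1) (y := 2) (by decide) (by decide) (by decide) rfl
        (by decide)
    · exact isMinMannheim_of hA hlow (x := 2) (y := 1) (by decide) (by decide) (by decide) rfl
        (by decide)
    · exact isMinMannheim_of hA hlow (x := 3) (y := 0) (by decide) (by decide) (by decide) rfl
        (by decide)
  · refine isMinMannheim_of hA ?_ (x := 1) (y := -3) ⟨by omega, by omega⟩ ⟨by omega, by omega⟩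
      ⟨0, by norm_num⟩ rfl one_ne_zero
    intro x y hdvd hlt
    -- Weight at most 3 gives `|3x + y| ≤ 9 < 11 ≤ q`. Then `y = -3x`, whose weight is `4|x|`.
    have h0 : 3 * x + y = 0 := by
      refine Int.eq_zero_of_abs_lt_dvd hdvd ?_
      rcases abs_cases x with ⟨e, _⟩ | ⟨e, _⟩ <;> rcases abs_cases y with ⟨e', _⟩ | ⟨e', _⟩ <;>
        rw [e, e'] at hlt <;> rw [abs_lt] <;> constructor <;> push_cast at hlt <;> omega
    rcases abs_cases x with ⟨e, _⟩ | ⟨e, _⟩ <;> rcases abs_cases y with ⟨e', _⟩ | ⟨e', _⟩ <;>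
      rw [e, e'] at hlt <;> push_cast at hlt <;> omega

theorem hasShortLoops_of_ge {q : ℕ} (hq : Odd q) (h : 11 ≤ q) : HasShortLoops q 3 := by
  have hq' := Nat.odd_iff.1 hq
  have h13 : IsLoop q 1 3 0 := isLoop_of_eq (by norm_num)
  have hz : ∀ x y : ℕ, 3 * x + y = q → 3 * (x : ZMod q) + y = 0 := by
    intro x y hxy
    have := congrArg (Nat.cast : ℕ → ZMod q) hxy
    rw [ZMod.natCast_self] at this
    push_cast at this
    exact this
  -- The second loop has `3x' + y' = q`, so its determinant with the loop `(1, 3)` is `q`, which is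
  -- odd. If `3 ∣ q`, then `m = q / 3` would give `3m = q`; trading one horizontal step for three
  -- vertical ones restores the strict inequality.
  by_cases h3 : q % 3 = 0
  · exact ⟨q / 3 - 1, 1, 3, q / 3 - 1, 3, _, _, h13,
      isLoop_of_add_eq_zero (hz _ _ (by omega)), by omega, by omega, by omega, by omega,
      by omega, by omega⟩
  · exact ⟨q / 3, 1, 3, q / 3, q % 3, _, _, h13,
      isLoop_of_add_eq_zero (hz _ _ (by omega)), by omega, by omega, by omega, by omega,
      by omega, by omega⟩

theorem toricCode_cyclicCode {n q : ℕ} (hn : 2 ≤ n) (hq : q = 2 * n + 1) {P : Finset (ℤ × ℤ)}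
    (hP : IsTessellation (cyclicCode q (2 * n - 2)) P) :
    IsStabilizerCode (toricCode (cyclicCode q (2 * n - 2)) P) ∧
      HasParameters (toricCode (cyclicCode q (2 * n - 2)) P) (2 * q) 2
        (if n ≤ 4 then 3 else 4) := by
  have : NeZero q := ⟨by omega⟩
  have hA := cyclicCode_eq_ker hq
  have hodd : Odd q := ⟨n, hq⟩
  have hne : ∀ k : ℕ, 0 < k → k < 5 → ((k : ℕ) : ZMod q) ≠ 0 := by
    intro k hk hk5 h
    have := Nat.le_of_dvd hk ((ZMod.natCast_eq_zero_iff _ _).1 h)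
    omega
  have h1 : (1 : ZMod q) ≠ 0 := by simpa using hne 1 (by norm_num) (by norm_num)
  have h3 : (3 : ZMod q) ≠ 0 := by simpa using hne 3 (by norm_num) (by norm_num)
  rw [toricCode_eq_cssCode hA hP h1 h3]
  refine ⟨isStabilizerCode_cssCode (bdry_dotProduct_grad _), ?_⟩
  split_ifs with h
  · have h' : n = 2 ∨ n = 3 ∨ n = 4 := by omega
    -- In each case `hl` is a loop with three steps, matching a codeword of least weight, and its
    -- determinant with `hl'` is again `q`.
    rcases h' with rfl | rfl | rfl <;> subst hq
    · have hl : IsLoop (2 * 2 + 1) 1 2 (3 * (1 : ℕ)) := isLoop_of_add_eq_zero (by decide)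
      have hl' : IsLoop (2 * 2 + 1) 2 1 0 := isLoop_of_eq (by decide)
      exact hasParameters_torus _ hodd ⟨2, _, _, _, _, _, _, hl, hl', by decide⟩ hl rfl (by decide)
    · have hl : IsLoop (2 * 3 + 1) 2 1 (3 * (2 : ℕ)) := isLoop_of_add_eq_zero (by decide)
      have hl' : IsLoop (2 * 3 + 1) 1 3 0 := isLoop_of_eq (by decide)
      exact hasParameters_torus _ hodd ⟨3, _, _, _, _, _, _, hl, hl', by decide⟩ hl rfl (by decide)
    · have hl : IsLoop (2 * 4 + 1) 3 0 (3 * (3 : ℕ)) := isLoop_of_add_eq_zero (by decide)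
      have hl' : IsLoop (2 * 4 + 1) 1 3 0 := isLoop_of_eq (by decide)
      exact hasParameters_torus _ hodd ⟨3, _, _, _, _, _, _, hl, hl', by decide⟩ hl rfl (by decide)
  · exact hasParameters_torus _ hodd (hasShortLoops_of_ge hodd (by omega))
      (isLoop_of_eq (x := 1) (y := 3) (by norm_num)) rfl (by decide)

end ToricCode

end

theorem mainTheorem4 (n q : ℕ) (hn : 2 ≤ n) (hq : q = 2 * n + 1) :
    (∃ P : Finset (ℤ × ℤ), ToricCode.IsTessellation (ToricCode.cyclicCode q (2 * n - 2)) P) ∧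
    ToricCode.IsMinMannheim (ToricCode.cyclicCode q (2 * n - 2)) (if n ≤ 4 then 3 else 4) ∧
    ∀ P : Finset (ℤ × ℤ), ToricCode.IsTessellation (ToricCode.cyclicCode q (2 * n - 2)) P →
      ToricCode.IsStabilizerCode
        (ToricCode.toricCode (ToricCode.cyclicCode q (2 * n - 2)) P) ∧
      ToricCode.HasParameters
        (ToricCode.toricCode (ToricCode.cyclicCode q (2 * n - 2)) P)
        (2 * q) 2 (if n ≤ 4 then 3 else 4) := by
  have : NeZero q := ⟨by omega⟩
  exact ⟨ToricCode.exists_isTessellation (ToricCode.cyclicCode_eq_ker hq),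
    ToricCode.isMinMannheim_cyclicCode hn hq,
    fun P hP => ToricCode.toricCode_cyclicCode hn hq hP⟩
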